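/- Let $H$ be a separable real Hilbert space with inner product $\langle\cdot,\cdot\rangle$ and norm $\|\cdot\|$, and let $X$ be a random variable with values in $H$. Assume: (A1) for every $h\in H$ there is $h'\in H$ with $\langle h,h'\rangle=0$ and $\operatorname{Var}(\langle X,h'\rangle)>0$ (the variance being $+\infty$, hence positive, if $\langle X,h'\rangle$ is not square integrable); (A2) there is a constant $C>0$ such that for all $h\in H$, $$\mathbb{E}\left[\frac{1}{\|X-h\|}\right]\le C \quad\text{and}\quad \mathbb{E}\left[\frac{1}{\|X-h\|^{2}}\right]\le C \qquad (\text{with } 1/0=+\infty).$$ Let $m$ be the geometric median of $X$, i.e. the minimizer over $h\in H$ of $\mathbb{E}\left[\|X-h\|-\|X\|\right]$. Let $X_1,X_2,\dots$ be independent random variables with the same law as $X$, let $c_\gamma>0$ and $\alpha\in(1/2,1)$, and put $\gamma_n=c_\gamma n^{-\alpha}$ for $n\ge 1$. Let $Z_1$ be an almost surely bounded $H$-valued random variable that is independent of the sequence $(X_2,X_3,\dots)$ (for example deterministic, or $Z_1=X_1\mathbf{1}_{\{\|X_1\|\le M\}}$), and define for $n\ge 1$ $$Z_{n+1}=Z_n+\gamma_n\,\frac{X_{n+1}-Z_n}{\|X_{n+1}-Z_n\|}$$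 (with the fraction read as $0$ on the null event $X_{n+1}=Z_n$). Then for every real $\beta<\alpha$, $$\|Z_n-m\|=o\left(\frac{1}{n^{\beta/2}}\right)\quad\text{almost surely, as } n\to\infty.$$ -/

import Mathlib

open MeasureTheory ProbabilityTheory Filter Topology Asymptotics
open scoped NNReal ENNReal

noncomputable section

/-- The function `h ↦ 𝔼[‖X - h‖ - ‖X‖]` minimized by the geometric median. The integrand is bounded
by `‖h‖`, so that it is integrable for every random variable `X`. -/
def medianObjective {Ω H : Type*} [MeasurableSpace Ω] [NormedAddCommGroup H]
    (X : Ω → H) (P : Measure Ω) (h : H) : ℝ :=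
  ∫ ω, (‖X ω - h‖ - ‖X ω‖) ∂P

/-- `m` is a geometric median of `X`: a minimizer of `h ↦ 𝔼[‖X - h‖ - ‖X‖]` over the whole space. -/
def IsGeometricMedian {Ω H : Type*} [MeasurableSpace Ω] [NormedAddCommGroup H]
    (X : Ω → H) (P : Measure Ω) (m : H) : Prop :=
  ∀ h : H, medianObjective X P m ≤ medianObjective X P h

/-- `X` is not concentrated on a straight line: every `h` has an orthogonal `h'` such that
`⟨X, h'⟩` has positive variance. The variance takes values in `[0, ∞]` (no second moment of `X` is
assumed): it is `∞`, in particular positive, if `⟨X, h'⟩` is not square integrable. -/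
def NotConcentratedOnLine {Ω H : Type*} [MeasurableSpace Ω] [NormedAddCommGroup H]
    [InnerProductSpace ℝ H] (X : Ω → H) (P : Measure Ω) : Prop :=
  ∀ h : H, ∃ h' : H, inner ℝ h h' = 0 ∧ 0 < evariance (fun ω => inner ℝ (X ω) h') P

/-- `X` is not concentrated around single points: `𝔼[1 / ‖X - h‖] ≤ C` and `𝔼[1 / ‖X - h‖²] ≤ C`
for all `h`, with one constant `C`. The expectations take values in `[0, ∞]`, with `1 / 0 = ∞`. -/
def NotConcentratedAroundPoints {Ω H : Type*} [MeasurableSpace Ω] [NormedAddCommGroup H]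
    (X : Ω → H) (P : Measure Ω) : Prop :=
  ∃ C : ℝ≥0, 0 < C ∧ ∀ h : H,
    ∫⁻ ω, (‖X ω - h‖ₑ)⁻¹ ∂P ≤ (C : ℝ≥0∞) ∧ ∫⁻ ω, (‖X ω - h‖ₑ ^ 2)⁻¹ ∂P ≤ (C : ℝ≥0∞)

end

/-! Let `F z = 𝔼[‖X - z‖ - ‖X - m‖]`, which is nonnegative because `m` is a minimizer. The
subgradient inequality bounds the drift `𝔼⟨unitDir X z, z - m⟩` by `-F z`, so a quadratic lower
bound for `F` near `m` makes the recursion contract. Such a bound holds on every ball: the defect in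
midpoint convexity of the norm dominates a weighted Gram determinant of `X - m` and `z - m`. By (A1)
the law of `X - m` charges a whole plane of directions. Some vector of that plane is orthogonal to
`z - m`, and Bessel's inequality then bounds the averaged Gram determinant below, uniformly in `z -
m` even in infinite dimension (`exists_pos_le_integral_weight_mul_gram`,
`exists_pos_integral_inner_unitDir_le`).

The contraction constant depends on the ball, so the iterates must be localized. The sign of the
drift and `∑ γₙ² < ∞` suffice for this: `‖Zₙ - m‖²` minus the partial sums of `γ²` is an L¹-bounded
supermartingale, so almost every path stays in some ball
(`IsMedianRecursion.ae_exists_forall_norm_sub_le`). It is enough to treat, for each integer radius,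
the process killed on leaving a ball.

For the killed squared distance `V`, the moments `𝔼 exp(sₙ Vₙ)` with `sₙ` of order `n^α` stay
bounded. The linear noise in one step is at most of order `γₙ‖Zₙ - m‖`, so its Hoeffding correction
is proportional to `Vₙ` and is absorbed by the contraction as long as `sₙ₊₁γₙ` is small compared
with it. Chernoff's bound and Borel–Cantelli then give `Vₙ < n^(-β)` eventually, for every `β < α`.
-/

/-! ### Quantitative convexity of the norm and planar linear algebra -/

section Convexity

variable {H : Type*} [NormedAddCommGroup H] [InnerProductSpace ℝ H]

/-- The unit vector pointing from `z` to `x`, equal to `0` if `x = z`. -/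
noncomputable def unitDir (x z : H) : H := ‖x - z‖⁻¹ • (x - z)

theorem norm_unitDir_le (x z : H) : ‖unitDir x z‖ ≤ 1 := by
  rw [unitDir, norm_smul, norm_inv, norm_norm]
  exact inv_mul_le_one

theorem abs_inner_unitDir_le (x z v : H) : |inner ℝ (unitDir x z) v| ≤ ‖v‖ :=
  (abs_real_inner_le_norm _ _).trans
    (mul_le_of_le_one_left (norm_nonneg _) (norm_unitDir_le x z))

/-- The subgradient inequality for the norm. -/
theorem inner_unitDir_le (x z m : H) :
    inner ℝ (unitDir x z) (z - m) ≤ ‖x - m‖ - ‖x - z‖ := by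
  have h : inner ℝ (unitDir x z) (x - z) = ‖x - z‖ := by
    rw [unitDir, real_inner_smul_left, real_inner_self_eq_norm_sq]
    rcases eq_or_ne ‖x - z‖ 0 with h0 | h0
    · simp [h0]
    · field_simp
  have h2 : inner ℝ (unitDir x z) (x - m) ≤ ‖x - m‖ :=
    (le_abs_self _).trans (abs_inner_unitDir_le _ _ _)
  have h3 : inner ℝ (unitDir x z) (z - m)
      = inner ℝ (unitDir x z) (x - m) - inner ℝ (unitDir x z) (x - z) := by
    rw [← inner_sub_right]; congr 1; abel
  linarith

/-- A quantitative form of the midpoint convexity of the norm. -/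
theorem gram_le_mul_midpoint_gap (a b : H) :
    ‖a‖ ^ 2 * ‖b‖ ^ 2 - inner ℝ a b ^ 2 ≤
      2 * (‖a‖ + ‖b‖) * (‖a‖ * ‖b‖) * (‖a‖ + ‖b‖ - ‖a + b‖) := by
  have h1 : ‖a + b‖ ^ 2 = ‖a‖ ^ 2 + 2 * inner ℝ a b + ‖b‖ ^ 2 := norm_add_sq_real a b
  have h2 := abs_le.1 (abs_real_inner_le_norm a b)
  have h3 : ‖a + b‖ ≤ ‖a‖ + ‖b‖ := norm_add_le a b
  -- Twice the left side is `(‖a‖ + ‖b‖)² - ‖a + b‖²`, a difference of squares.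
  have h4 : ‖a‖ * ‖b‖ - inner ℝ a b ≤ (‖a‖ + ‖b‖) * (‖a‖ + ‖b‖ - ‖a + b‖) := by
    nlinarith [sq_nonneg (‖a‖ + ‖b‖ - ‖a + b‖)]
  have h5 : 0 ≤ ‖a‖ * ‖b‖ - inner ℝ a b := by linarith
  calc ‖a‖ ^ 2 * ‖b‖ ^ 2 - inner ℝ a b ^ 2
      = (‖a‖ * ‖b‖ + inner ℝ a b) * (‖a‖ * ‖b‖ - inner ℝ a b) := by ring
    _ ≤ (2 * (‖a‖ * ‖b‖)) * (‖a‖ * ‖b‖ - inner ℝ a b) := by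
        apply mul_le_mul_of_nonneg_right _ h5; linarith
    _ ≤ (2 * (‖a‖ * ‖b‖)) * ((‖a‖ + ‖b‖) * (‖a‖ + ‖b‖ - ‖a + b‖)) := by
        apply mul_le_mul_of_nonneg_left h4; positivity
    _ = _ := by ring

/-- A quantitative form of the midpoint convexity of the norm, with a weight that depends on one
end point only. -/
theorem gram_mul_weight_le_midpoint_gap (a u : H) {R : ℝ} (hR : 0 < R) (hu : ‖u‖ ≤ R) :
    ((‖a‖ + R) ^ 3)⁻¹ * (‖a‖ ^ 2 * ‖u‖ ^ 2 - inner ℝ a u ^ 2) ≤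
      4 * (‖a‖ + ‖a - u‖ - ‖a + (a - u)‖) := by
  have ha : 0 < ‖a‖ + R := add_pos_of_nonneg_of_pos (norm_nonneg _) hR
  have h1 := gram_le_mul_midpoint_gap a (a - u)
  have h2 : ‖a‖ ^ 2 * ‖a - u‖ ^ 2 - inner ℝ a (a - u) ^ 2
      = ‖a‖ ^ 2 * ‖u‖ ^ 2 - inner ℝ a u ^ 2 := by
    rw [norm_sub_sq_real, inner_sub_right, real_inner_self_eq_norm_sq]; ring
  have h3 : ‖a - u‖ ≤ ‖a‖ + R := (norm_sub_le _ _).trans (by linarith)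
  have h4 : 0 ≤ ‖a‖ + ‖a - u‖ - ‖a + (a - u)‖ := sub_nonneg.2 (norm_add_le _ _)
  rw [inv_mul_le_iff₀ (by positivity), ← h2]
  refine h1.trans ?_
  have h5 : 2 * (‖a‖ + ‖a - u‖) * (‖a‖ * ‖a - u‖) ≤ (‖a‖ + R) ^ 3 * 4 := by
    have : ‖a‖ ≤ ‖a‖ + R := by linarith
    calc 2 * (‖a‖ + ‖a - u‖) * (‖a‖ * ‖a - u‖)
        ≤ 2 * ((‖a‖ + R) + (‖a‖ + R)) * ((‖a‖ + R) * (‖a‖ + R)) := by gcongr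
      _ = _ := by ring
  calc _ ≤ ((‖a‖ + R) ^ 3 * 4) * (‖a‖ + ‖a - u‖ - ‖a + (a - u)‖) :=
        mul_le_mul_of_nonneg_right h5 h4
    _ = _ := by ring

/-- Bessel's inequality for two orthogonal vectors. -/
theorem sq_inner_mul_le_gram (a u v : H) (huv : inner ℝ u v = 0) :
    inner ℝ a v ^ 2 * ‖u‖ ^ 2 ≤ ‖v‖ ^ 2 * (‖a‖ ^ 2 * ‖u‖ ^ 2 - inner ℝ a u ^ 2) := by
  rcases eq_or_ne u 0 with rfl | hu
  · simp
  have hu' : 0 < ‖u‖ ^ 2 := by positivity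
  set w : H := ‖u‖ ^ 2 • a - inner ℝ a u • u with hw
  have h1 : inner ℝ w v = ‖u‖ ^ 2 * inner ℝ a v := by
    rw [hw, inner_sub_left, real_inner_smul_left, real_inner_smul_left, huv]; ring
  have h2 : ‖w‖ ^ 2 = ‖u‖ ^ 2 * (‖a‖ ^ 2 * ‖u‖ ^ 2 - inner ℝ a u ^ 2) := by
    rw [hw, norm_sub_sq_real, norm_smul, norm_smul, real_inner_smul_left, real_inner_smul_right]
    simp only [norm_pow, Real.norm_eq_abs, mul_pow, sq_abs]; ring
  have h3 : inner ℝ w v ^ 2 ≤ ‖w‖ ^ 2 * ‖v‖ ^ 2 := by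
    rw [← mul_pow]
    exact sq_le_sq.2 ((abs_real_inner_le_norm _ _).trans (le_abs_self _))
  rw [h1, h2] at h3
  refine le_of_mul_le_mul_left ?_ hu'
  linarith

/-- Some combination of `f` and `g` with coefficients on the unit circle is orthogonal to `u`. -/
theorem exists_mem_span_pair_orthogonal (f g u : H) :
    ∃ s t : ℝ, s ^ 2 + t ^ 2 = 1 ∧ inner ℝ u (s • f + t • g) = 0 := by
  set p := inner ℝ u f with hp
  set q := inner ℝ u g with hq
  by_cases h : p ^ 2 + q ^ 2 = 0
  · have h1 : p = 0 := by nlinarith [sq_nonneg p, sq_nonneg q]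
    exact ⟨1, 0, by norm_num, by simp [← hp, h1]⟩
  · have h0 : 0 < p ^ 2 + q ^ 2 := lt_of_le_of_ne (by positivity) (Ne.symm h)
    -- The vector `(p, q)`, normalized and turned by a right angle.
    refine ⟨q / √(p ^ 2 + q ^ 2), -p / √(p ^ 2 + q ^ 2), ?_, ?_⟩
    · rw [div_pow, div_pow, Real.sq_sqrt h0.le]; field_simp; ring
    · rw [inner_add_right, real_inner_smul_right, real_inner_smul_right, ← hp, ← hq]; ring

/-- A binary quadratic form that is positive away from the origin is bounded below on the unit
circle. -/
theorem exists_pos_le_of_binary_form_pos {A B C : ℝ}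
    (h : ∀ s t : ℝ, (s ≠ 0 ∨ t ≠ 0) → 0 < A * s ^ 2 + 2 * B * (s * t) + C * t ^ 2) :
    ∃ k > 0, ∀ s t : ℝ, s ^ 2 + t ^ 2 = 1 → k ≤ A * s ^ 2 + 2 * B * (s * t) + C * t ^ 2 := by
  have hA : 0 < A := by simpa using h 1 0 (by simp)
  have hC : 0 < C := by simpa using h 0 1 (by simp)
  have hD : 0 < A * C - B ^ 2 := by
    have := h (-B) A (Or.inr hA.ne')
    refine pos_of_mul_pos_right (b := A * C - B ^ 2) (a := A) ?_ hA.le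
    linarith
  -- Determinant over trace of the matrix `M` of the form; the identity `e` below is
  -- Cayley–Hamilton, `tr M · M = det M + M²`.
  refine ⟨(A * C - B ^ 2) / (A + C), by positivity, fun s t hst => ?_⟩
  rw [div_le_iff₀ (by positivity)]
  have e : (A * s ^ 2 + 2 * B * (s * t) + C * t ^ 2) * (A + C)
      = (A * C - B ^ 2) * (s ^ 2 + t ^ 2) + (A * s + B * t) ^ 2 + (B * s + C * t) ^ 2 := by ring
  rw [e, hst]
  nlinarith [sq_nonneg (A * s + B * t), sq_nonneg (B * s + C * t)]

end Convexity

/-! ### Directions charged by the law -/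

section Nondegeneracy

variable {H : Type*} [NormedAddCommGroup H] [InnerProductSpace ℝ H] [MeasurableSpace H]

variable (ν : Measure H) (m : H)

/-- The vectors orthogonal to almost every `x - m`. -/
def aeOrthogonal : Submodule ℝ H where
  carrier := {v | ∀ᵐ x ∂ν, inner ℝ v (x - m) = 0}
  add_mem' := by
    intro a b ha hb
    change ∀ᵐ x ∂ν, inner ℝ (a + b) (x - m) = 0
    filter_upwards [ha, hb] with x h1 h2
    rw [inner_add_left, h1, h2, add_zero]
  zero_mem' := by simp
  smul_mem' := by
    intro c a ha
    change ∀ᵐ x ∂ν, inner ℝ (c • a) (x - m) = 0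
    filter_upwards [ha] with x h1
    rw [real_inner_smul_left, h1, mul_zero]

theorem mem_aeOrthogonal {v : H} :
    v ∈ aeOrthogonal ν m ↔ ∀ᵐ x ∂ν, inner ℝ v (x - m) = 0 := Iff.rfl

theorem isClosed_aeOrthogonal : IsClosed (aeOrthogonal ν m : Set H) := by
  refine IsSeqClosed.isClosed fun v a hv ha => ?_
  have h : ∀ᵐ x ∂ν, ∀ n, inner ℝ (v n) (x - m) = 0 := ae_all_iff.2 hv
  change ∀ᵐ x ∂ν, inner ℝ a (x - m) = 0
  filter_upwards [h] with x hx
  have h1 : Tendsto (fun n => inner ℝ (v n) (x - m)) atTop (𝓝 (inner ℝ a (x - m))) :=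
    ha.inner tendsto_const_nhds
  simp only [hx] at h1
  exact (tendsto_nhds_unique h1 tendsto_const_nhds)

/-- Projecting onto the orthogonal complement of the closed subspace `N` of degenerate directions
changes a vector only by an element of `N`. A nondegenerate vector thus projects to some `f ≠ 0`,
and a nondegenerate vector orthogonal to `f` projects to some `g ≠ 0`, still orthogonal to `f`.
Combinations of `f` and `g` lie in `Nᗮ`, so they meet `N` only at zero. -/
theorem exists_orthogonal_pair [CompleteSpace H]
    (hA : ∀ h : H, ∃ h' : H, inner ℝ h h' = 0 ∧ h' ∉ aeOrthogonal ν m) :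
    ∃ f g : H, ∀ s t : ℝ, (s ≠ 0 ∨ t ≠ 0) → s • f + t • g ∉ aeOrthogonal ν m := by
  set N := aeOrthogonal ν m
  have : CompleteSpace N := (isClosed_aeOrthogonal ν m).completeSpace_coe
  have key : ∀ h : H, h ∉ N → ∃ k ∈ Nᗮ, k ≠ 0 ∧ h - k ∈ N := by
    intro h hh
    refine ⟨h - N.starProjection h, N.sub_starProjection_mem_orthogonal h, fun h0 => hh ?_, ?_⟩
    · rw [sub_eq_zero.1 h0]; exact N.starProjection_apply_mem h
    · simp
  obtain ⟨h₁, -, h₁N⟩ := hA 0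
  obtain ⟨f, hf, hf0, -⟩ := key h₁ h₁N
  obtain ⟨h₂, hfh₂, h₂N⟩ := hA f
  obtain ⟨g, hg, hg0, hgN⟩ := key h₂ h₂N
  have hfg : inner ℝ f g = 0 := by
    have := N.inner_left_of_mem_orthogonal hgN hf
    rw [inner_sub_right, hfh₂] at this
    linarith
  refine ⟨f, g, fun s t hst hmem => ?_⟩
  have hz : s • f + t • g = 0 := by
    have h1 : s • f + t • g ∈ Nᗮ := add_mem (Nᗮ.smul_mem _ hf) (Nᗮ.smul_mem _ hg)
    exact inner_self_eq_zero.1 (N.inner_right_of_mem_orthogonal hmem h1)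
  have e1 : s * ‖f‖ ^ 2 = 0 := by
    have : inner ℝ f (s • f + t • g) = 0 := by rw [hz, inner_zero_right]
    simpa [inner_add_right, real_inner_smul_right, hfg, real_inner_self_eq_norm_sq] using this
  have e2 : t * ‖g‖ ^ 2 = 0 := by
    have : inner ℝ (s • f + t • g) g = 0 := by rw [hz, inner_zero_left]
    simpa [inner_add_left, real_inner_smul_left, hfg, real_inner_self_eq_norm_sq] using this
  rcases hst with h | h
  · exact h ((mul_eq_zero.1 e1).resolve_right (by positivity))
  · exact h ((mul_eq_zero.1 e2).resolve_right (by positivity))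

end Nondegeneracy

theorem integrable_norm_sub_sub_norm_sub {H : Type*} [NormedAddCommGroup H]
    [MeasurableSpace H] [BorelSpace H] (ν : Measure H) [IsProbabilityMeasure ν] (a b : H) :
    Integrable (fun x => ‖x - a‖ - ‖x - b‖) ν := by
  refine Integrable.of_bound (by fun_prop) ‖b - a‖ (ae_of_all _ fun x => ?_)
  have := abs_norm_sub_norm_le (x - a) (x - b)
  rwa [sub_sub_sub_cancel_left] at this

/-- The cubic decay of the weight beats quadratic growth, so no moment of the law is needed. -/
theorem integrable_weight_mul {H : Type*} [NormedAddCommGroup H]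
    [MeasurableSpace H] [BorelSpace H] {ν : Measure H} [IsProbabilityMeasure ν] (m : H) {R : ℝ}
    (hR : 0 < R) {φ : H → ℝ} (hφ : Measurable φ) {D : ℝ}
    (hD : ∀ x, |φ x| ≤ D * ‖x - m‖ ^ 2) :
    Integrable (fun x => ((‖x - m‖ + R) ^ 3)⁻¹ * φ x) ν := by
  refine Integrable.of_bound (by fun_prop) (|D| / R) (ae_of_all _ fun x => ?_)
  have h0 : 0 < ‖x - m‖ + R := add_pos_of_nonneg_of_pos (norm_nonneg _) hR
  rw [norm_mul, norm_inv, norm_pow, Real.norm_of_nonneg h0.le, Real.norm_eq_abs,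
    inv_mul_le_iff₀ (by positivity)]
  calc |φ x| ≤ D * ‖x - m‖ ^ 2 := hD x
    _ ≤ |D| * (‖x - m‖ + R) ^ 2 := by
        gcongr
        · exact le_abs_self D
        · linarith
    _ ≤ |D| * ((‖x - m‖ + R) ^ 2 * ((‖x - m‖ + R) / R)) := by
        gcongr
        refine le_mul_of_one_le_right (by positivity) ((one_le_div hR).2 ?_)
        linarith [norm_nonneg (x - m)]
    _ = _ := by field_simp

/-! ### Monotonicity of the expected direction -/

section Monotonicity

variable {H : Type*} [NormedAddCommGroup H] [InnerProductSpace ℝ H]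
  [MeasurableSpace H] [BorelSpace H] [SecondCountableTopology H]

@[fun_prop]
theorem measurable_unitDir : Measurable (fun p : H × H => unitDir p.1 p.2) := by
  unfold unitDir; fun_prop

theorem integrable_inner_unitDir (ν : Measure H) [IsProbabilityMeasure ν] (z v : H) :
    Integrable (fun x => inner ℝ (unitDir x z) v) ν := by
  refine Integrable.of_bound ?_ ‖v‖ (ae_of_all _ fun x => abs_inner_unitDir_le x z v)
  have : Measurable fun x : H => unitDir x z :=
    measurable_unitDir.comp (measurable_id.prodMk measurable_const)
  exact (this.inner measurable_const).aestronglyMeasurable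

/-- The weighted second moment form is positive definite on the plane of `f` and `g`, hence bounded
below on coefficients of unit length. For each `u`, such a combination orthogonal to `u` transfers
this bound to the Gram determinant by Bessel's inequality. Only the fixed plane enters, which makes
`k` independent of `u`. -/
theorem exists_pos_le_integral_weight_mul_gram [CompleteSpace H]
    (ν : Measure H) [IsProbabilityMeasure ν] (m : H)
    (hA : ∀ h : H, ∃ h' : H, inner ℝ h h' = 0 ∧ h' ∉ aeOrthogonal ν m) {R : ℝ} (hR : 0 < R) :
    ∃ k > 0, ∀ u : H, k * ‖u‖ ^ 2 ≤
      ∫ x, ((‖x - m‖ + R) ^ 3)⁻¹ * (‖x - m‖ ^ 2 * ‖u‖ ^ 2 - inner ℝ (x - m) u ^ 2) ∂ν := by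
  obtain ⟨f, g, hfg⟩ := exists_orthogonal_pair ν m hA
  set w : H → ℝ := fun x => ((‖x - m‖ + R) ^ 3)⁻¹ with hw
  have hw0 : ∀ x, 0 < w x := fun x => by
    have : 0 < ‖x - m‖ + R := add_pos_of_nonneg_of_pos (norm_nonneg _) hR
    simp only [hw]; positivity
  have hint : ∀ p q : H, Integrable (fun x => w x * (inner ℝ (x - m) p * inner ℝ (x - m) q)) ν := by
    intro p q
    refine integrable_weight_mul m hR (by fun_prop) (D := ‖p‖ * ‖q‖) fun x => ?_
    rw [abs_mul]
    calc _ ≤ (‖x - m‖ * ‖p‖) * (‖x - m‖ * ‖q‖) := by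
          gcongr <;> exact abs_real_inner_le_norm _ _
      _ = _ := by ring
  set Q : H → H → ℝ := fun p q => ∫ x, w x * (inner ℝ (x - m) p * inner ℝ (x - m) q) ∂ν with hQ
  have hform : ∀ s t : ℝ, ∫ x, w x * inner ℝ (x - m) (s • f + t • g) ^ 2 ∂ν
      = Q f f * s ^ 2 + 2 * Q f g * (s * t) + Q g g * t ^ 2 := by
    intro s t
    have : ∀ x, w x * inner ℝ (x - m) (s • f + t • g) ^ 2
        = s ^ 2 * (w x * (inner ℝ (x - m) f * inner ℝ (x - m) f))
          + 2 * (s * t) * (w x * (inner ℝ (x - m) f * inner ℝ (x - m) g))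
          + t ^ 2 * (w x * (inner ℝ (x - m) g * inner ℝ (x - m) g)) := by
      intro x
      rw [inner_add_right, real_inner_smul_right, real_inner_smul_right]; ring
    simp_rw [this]
    have i1 := (hint f f).const_mul (s ^ 2)
    have i2 := (hint f g).const_mul (2 * (s * t))
    rw [integral_add (i1.add i2 : Integrable (fun _ => _ + _) ν) ((hint g g).const_mul _),
      integral_add i1 i2, integral_const_mul, integral_const_mul, integral_const_mul]
    simp only [hQ]; ring
  have hsq : ∀ v : H, Integrable (fun x => w x * inner ℝ (x - m) v ^ 2) ν := by
    intro v; simpa only [sq] using hint v v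
  obtain ⟨k, hk, hkle⟩ := exists_pos_le_of_binary_form_pos (A := Q f f) (B := Q f g) (C := Q g g)
    (by
      intro s t hst
      rw [← hform]
      have h0 : 0 ≤ᵐ[ν] fun x => w x * inner ℝ (x - m) (s • f + t • g) ^ 2 :=
        ae_of_all _ fun x => mul_nonneg (hw0 x).le (sq_nonneg _)
      refine lt_of_le_of_ne (integral_nonneg_of_ae h0) fun h => hfg s t hst ?_
      have h1 := (integral_eq_zero_iff_of_nonneg_ae h0 (hsq _)).1 h.symm
      rw [mem_aeOrthogonal]
      filter_upwards [h1] with x hx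
      rw [real_inner_comm]
      simpa [(hw0 x).ne'] using hx)
  -- Bounds the squared norm of every admissible combination; the `1` only keeps it visibly
  -- positive.
  set B : ℝ := (‖f‖ + ‖g‖) ^ 2 + 1 with hB
  have hB0 : 0 < B := by positivity
  refine ⟨k / B, by positivity, fun u => ?_⟩
  obtain ⟨s, t, hst, huv⟩ := exists_mem_span_pair_orthogonal f g u
  have hv : ‖s • f + t • g‖ ^ 2 ≤ B := by
    have hs : |s| ≤ 1 := abs_le_one_iff_mul_self_le_one.2 (by nlinarith [sq_nonneg t])
    have ht : |t| ≤ 1 := abs_le_one_iff_mul_self_le_one.2 (by nlinarith [sq_nonneg s])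
    have h1 : ‖s • f + t • g‖ ≤ ‖f‖ + ‖g‖ := by
      refine (norm_add_le _ _).trans (add_le_add ?_ ?_)
      · rw [norm_smul]; exact mul_le_of_le_one_left (norm_nonneg _) hs
      · rw [norm_smul]; exact mul_le_of_le_one_left (norm_nonneg _) ht
    have := pow_le_pow_left₀ (norm_nonneg _) h1 2
    linarith
  have hgram : ∀ x, 0 ≤ ‖x - m‖ ^ 2 * ‖u‖ ^ 2 - inner ℝ (x - m) u ^ 2 := fun x => by
    have := sq_le_sq.2 ((abs_real_inner_le_norm (x - m) u).trans (le_abs_self _))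
    rw [mul_pow] at this; linarith
  have hgint : Integrable
      (fun x => w x * (‖x - m‖ ^ 2 * ‖u‖ ^ 2 - inner ℝ (x - m) u ^ 2)) ν := by
    refine integrable_weight_mul m hR (by fun_prop) (D := ‖u‖ ^ 2) fun x => ?_
    rw [abs_of_nonneg (hgram x)]
    nlinarith [sq_nonneg (inner ℝ (x - m) u)]
  have hmono : ∫ x, ‖u‖ ^ 2 * (w x * inner ℝ (x - m) (s • f + t • g) ^ 2) ∂ν ≤
      ∫ x, B * (w x * (‖x - m‖ ^ 2 * ‖u‖ ^ 2 - inner ℝ (x - m) u ^ 2)) ∂ν := by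
    refine integral_mono ((hsq _).const_mul _) (hgint.const_mul _) fun x => ?_
    have h1 := sq_inner_mul_le_gram (x - m) u _ huv
    have h2 := mul_le_mul_of_nonneg_right hv (hgram x)
    have h3 := mul_le_mul_of_nonneg_left (h1.trans h2) (hw0 x).le
    calc _ = w x * (inner ℝ (x - m) (s • f + t • g) ^ 2 * ‖u‖ ^ 2) := by ring
      _ ≤ _ := h3
      _ = _ := by ring
  rw [integral_const_mul, integral_const_mul, hform] at hmono
  rw [div_mul_eq_mul_div, div_le_iff₀ hB0]
  nlinarith [mul_le_mul_of_nonneg_left (hkle s t hst) (sq_nonneg ‖u‖)]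

/-- The expected direction is strongly monotone on balls around the geometric median. -/
theorem exists_pos_integral_inner_unitDir_le [CompleteSpace H]
    (ν : Measure H) [IsProbabilityMeasure ν] (m : H)
    (hA : ∀ h : H, ∃ h' : H, inner ℝ h h' = 0 ∧ h' ∉ aeOrthogonal ν m)
    (hm : ∀ h : H, 0 ≤ ∫ x, (‖x - h‖ - ‖x - m‖) ∂ν) {R : ℝ} (hR : 0 < R) :
    ∃ k > 0, ∀ z : H, ‖z - m‖ ≤ R →
      ∫ x, inner ℝ (unitDir x z) (z - m) ∂ν ≤ -(k * ‖z - m‖ ^ 2) := by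
  obtain ⟨k, hk, hkle⟩ := exists_pos_le_integral_weight_mul_gram ν m hA hR
  refine ⟨k / 4, by positivity, fun z hz => ?_⟩
  set u := z - m with hu
  -- The midpoint of `m` and `z`: since the objective there is no smaller than at `m`, the whole
  -- convexity defect is a lower bound for the objective at `z`.
  set h : H := m + (2⁻¹ : ℝ) • u with hh
  have i1 := integrable_norm_sub_sub_norm_sub ν z m
  have i2 := integrable_norm_sub_sub_norm_sub ν h m
  have h1 : ∫ x, inner ℝ (unitDir x z) u ∂ν ≤ -∫ x, (‖x - z‖ - ‖x - m‖) ∂ν := by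
    rw [← integral_neg]
    refine integral_mono (integrable_inner_unitDir ν z u) i1.neg fun x => ?_
    have := inner_unitDir_le x z m
    simp only [hu]; linarith
  have h2 : ∫ x, ((‖x - m‖ + R) ^ 3)⁻¹ * (‖x - m‖ ^ 2 * ‖u‖ ^ 2 - inner ℝ (x - m) u ^ 2) ∂ν
      ≤ ∫ x, (4 * (‖x - z‖ - ‖x - m‖) - 8 * (‖x - h‖ - ‖x - m‖)) ∂ν := by
    refine integral_mono_of_nonneg (ae_of_all _ fun x => ?_)
      ((i1.const_mul 4).sub (i2.const_mul 8)) (ae_of_all _ fun x => ?_)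
    · have := sq_le_sq.2 ((abs_real_inner_le_norm (x - m) u).trans (le_abs_self _))
      rw [mul_pow] at this
      exact mul_nonneg (by positivity) (by linarith)
    · have := gram_mul_weight_le_midpoint_gap (x - m) u hR hz
      have e1 : x - m - u = x - z := by rw [hu]; abel
      have e2 : ‖x - m + (x - z)‖ = 2 * ‖x - h‖ := by
        have : x - m + (x - z) = (2 : ℝ) • (x - h) := by
          rw [hh, hu]; module
        rw [this, norm_smul]; norm_num
      rw [e1, e2] at this
      simp only; linarith
  rw [integral_sub (i1.const_mul 4) (i2.const_mul 8), integral_const_mul, integral_const_mul] at h2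
  linarith [hkle u, hm h]

/-- The expected direction is monotone. -/
theorem integral_inner_unitDir_nonpos (ν : Measure H) [IsProbabilityMeasure ν] (m : H)
    (hm : ∀ h : H, 0 ≤ ∫ x, (‖x - h‖ - ‖x - m‖) ∂ν) (z : H) :
    ∫ x, inner ℝ (unitDir x z) (z - m) ∂ν ≤ 0 := by
  calc ∫ x, inner ℝ (unitDir x z) (z - m) ∂ν ≤ ∫ x, -(‖x - z‖ - ‖x - m‖) ∂ν := by
        refine integral_mono (integrable_inner_unitDir ν z _)
          (integrable_norm_sub_sub_norm_sub ν z m).neg fun x => ?_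
        have := inner_unitDir_le x z m
        simp only; linarith
    _ ≤ 0 := by rw [integral_neg]; linarith [hm z]

end Monotonicity

/-! ### Freezing the past -/

section Independence

/-- Both hypotheses together make the law of the triple a threefold product, which may be bracketed
either way. -/
theorem indepFun_prodMk_left_of_prodMk_right {Ω α β γ : Type*} [MeasurableSpace Ω]
    [MeasurableSpace α] [MeasurableSpace β] [MeasurableSpace γ] {μ : Measure Ω}
    [IsProbabilityMeasure μ] {f : Ω → α} {g : Ω → β} {k : Ω → γ} (hf : Measurable f)
    (hg : Measurable g) (hk : Measurable k) (h₁ : IndepFun f (fun ω => (g ω, k ω)) μ) (h₂ : IndepFun g k μ) :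
    IndepFun (fun ω => (f ω, g ω)) k μ := by
  have : IsProbabilityMeasure (μ.map f) := Measure.isProbabilityMeasure_map hf.aemeasurable
  have : IsProbabilityMeasure (μ.map g) := Measure.isProbabilityMeasure_map hg.aemeasurable
  have : IsProbabilityMeasure (μ.map k) := Measure.isProbabilityMeasure_map hk.aemeasurable
  have hfg : IndepFun f g μ := h₁.comp measurable_id measurable_fst
  have e₁ := (indepFun_iff_map_prod_eq_prod_map_map hf.aemeasurable
    (hg.prodMk hk).aemeasurable).1 h₁
  have e₂ := (indepFun_iff_map_prod_eq_prod_map_map hg.aemeasurable hk.aemeasurable).1 h₂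
  have e₃ := (indepFun_iff_map_prod_eq_prod_map_map hf.aemeasurable hg.aemeasurable).1 hfg
  rw [indepFun_iff_map_prod_eq_prod_map_map (hf.prodMk hg).aemeasurable hk.aemeasurable, e₃]
  apply MeasurableEquiv.prodAssoc.map_measurableEquiv_injective
  rw [Measure.prodAssoc_prod, ← e₂, ← e₁,
    Measure.map_map MeasurableEquiv.prodAssoc.measurable ((hf.prodMk hg).prodMk hk)]
  rfl

/-- Integrating out a variable that is independent of the past. -/
theorem integral_eq_integral_integral_of_indep {Ω T E : Type*} {𝒢 : MeasurableSpace Ω}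
    [mΩ : MeasurableSpace Ω] [MeasurableSpace T] [MeasurableSpace E] {μ : Measure Ω}
    [IsProbabilityMeasure μ] {ν : Measure E} (h𝒢 : 𝒢 ≤ mΩ) {S : Ω → T} (hS : Measurable[𝒢] S)
    {Y : Ω → E} (hY : Measurable Y) (hind : Indep 𝒢 (MeasurableSpace.comap Y inferInstance) μ)
    (hν : μ.map Y = ν) {φ : T → E → ℝ} (hφ : Measurable (Function.uncurry φ))
    (hint : Integrable (fun ω => φ (S ω) (Y ω)) μ) :
    ∫ ω, φ (S ω) (Y ω) ∂μ = ∫ ω, ∫ y, φ (S ω) y ∂ν ∂μ := by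
  have hS' : Measurable S := hS.mono h𝒢 le_rfl
  have hSY : IndepFun S Y μ :=
    (IndepFun_iff_Indep _ _ _).2 (indep_of_indep_of_le_left hind hS.comap_le)
  have : IsProbabilityMeasure ν := hν ▸ Measure.isProbabilityMeasure_map hY.aemeasurable
  have : IsProbabilityMeasure (μ.map S) := Measure.isProbabilityMeasure_map hS'.aemeasurable
  have e := (indepFun_iff_map_prod_eq_prod_map_map hS'.aemeasurable hY.aemeasurable).1 hSY
  rw [hν] at e
  have hm : AEMeasurable (fun ω => (S ω, Y ω)) μ := (hS'.prodMk hY).aemeasurable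
  have hint' : Integrable (Function.uncurry φ) ((μ.map S).prod ν) := by
    rw [← e, integrable_map_measure hφ.aestronglyMeasurable hm]; exact hint
  have h1 : ∫ ω, φ (S ω) (Y ω) ∂μ = ∫ p, Function.uncurry φ p ∂((μ.map S).prod ν) := by
    rw [← e, integral_map hm hφ.aestronglyMeasurable]; rfl
  rw [h1, integral_prod _ hint']
  exact integral_map hS'.aemeasurable
    (hφ.stronglyMeasurable.integral_prod_right (f := φ)).aestronglyMeasurable

end Independence

/-! ### The recursion and almost sure boundedness -/

section Recursion

variable {H : Type*} [NormedAddCommGroup H] [InnerProductSpace ℝ H]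
  [MeasurableSpace H] {Ω : Type*} [mΩ : MeasurableSpace Ω]

/-- The stochastic gradient recursion for the geometric median of `ν` with step
sizes `γ`, driven by observations `Y n` that are independent of the past `ℱ n`. -/
structure IsMedianRecursion (μ : Measure Ω) (ν : Measure H) (ℱ : Filtration ℕ mΩ) (γ : ℕ → ℝ)
    (Y Z : ℕ → Ω → H) : Prop where
  adapted : ∀ n, Measurable[ℱ n] (Z n)
  measurable_obs : ∀ n, Measurable (Y n)
  indep : ∀ n, Indep (ℱ n) (MeasurableSpace.comap (Y n) inferInstance) μ
  map_eq : ∀ n, μ.map (Y n) = ν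
  step : ∀ n ω, Z (n + 1) ω = Z n ω + γ n • unitDir (Y n ω) (Z n ω)
  step_nonneg : ∀ n, 0 ≤ γ n
  bdd_init : ∃ M : ℝ, ∀ᵐ ω ∂μ, ‖Z 0 ω‖ ≤ M

namespace IsMedianRecursion

variable {μ : Measure Ω} {ν : Measure H} {ℱ : Filtration ℕ mΩ}
  {γ : ℕ → ℝ} {Y Z : ℕ → Ω → H} (m : H)

theorem norm_sub_sq_succ_le (hR : IsMedianRecursion μ ν ℱ γ Y Z) (n : ℕ) (ω : Ω) :
    ‖Z (n + 1) ω - m‖ ^ 2 ≤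
      ‖Z n ω - m‖ ^ 2 + 2 * γ n * inner ℝ (unitDir (Y n ω) (Z n ω)) (Z n ω - m) + γ n ^ 2 := by
  have e : Z (n + 1) ω - m = (Z n ω - m) + γ n • unitDir (Y n ω) (Z n ω) := by
    rw [hR.step]; abel
  have h1 := pow_le_pow_left₀ (norm_nonneg _) (norm_unitDir_le (Y n ω) (Z n ω)) 2
  rw [e, norm_add_sq_real, real_inner_smul_right, norm_smul, real_inner_comm, mul_pow,
    Real.norm_eq_abs, sq_abs]
  nlinarith [mul_le_mul_of_nonneg_left h1 (sq_nonneg (γ n))]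

/-- Each step has length at most `γ n`. The bound depends on `n` and serves integrability only. -/
theorem exists_ae_norm_sub_le (hR : IsMedianRecursion μ ν ℱ γ Y Z) (n : ℕ) :
    ∃ B : ℝ, 0 ≤ B ∧ ∀ᵐ ω ∂μ, ‖Z n ω - m‖ ≤ B := by
  induction n with
  | zero =>
    obtain ⟨M, hM⟩ := hR.bdd_init
    refine ⟨|M| + ‖m‖, by positivity, ?_⟩
    filter_upwards [hM] with ω hω
    exact (norm_sub_le _ _).trans (by linarith [le_abs_self M])
  | succ n ih =>
    obtain ⟨B, hB0, hB⟩ := ih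
    refine ⟨B + γ n, add_nonneg hB0 (hR.step_nonneg n), ?_⟩
    filter_upwards [hB] with ω hω
    have e : Z (n + 1) ω - m = (Z n ω - m) + γ n • unitDir (Y n ω) (Z n ω) := by
      rw [hR.step]; abel
    rw [e]
    refine (norm_add_le _ _).trans (add_le_add hω ?_)
    rw [norm_smul, Real.norm_of_nonneg (hR.step_nonneg n)]
    exact mul_le_of_le_one_right (hR.step_nonneg n) (norm_unitDir_le _ _)

theorem measurable_iterate (hR : IsMedianRecursion μ ν ℱ γ Y Z) (n : ℕ) : Measurable (Z n) :=
  (hR.adapted n).mono (ℱ.le n) le_rfl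

theorem isProbabilityMeasure [IsProbabilityMeasure μ] (hR : IsMedianRecursion μ ν ℱ γ Y Z) :
    IsProbabilityMeasure ν :=
  hR.map_eq 0 ▸ Measure.isProbabilityMeasure_map (hR.measurable_obs 0).aemeasurable

variable [BorelSpace H] [SecondCountableTopology H]

theorem measurable_inner_unitDir (hR : IsMedianRecursion μ ν ℱ γ Y Z) (n : ℕ) :
    Measurable (fun ω => inner ℝ (unitDir (Y n ω) (Z n ω)) (Z n ω - m)) :=
  (measurable_unitDir.comp ((hR.measurable_obs n).prodMk (hR.measurable_iterate n))).inner
    ((hR.measurable_iterate n).sub_const m)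

variable [IsProbabilityMeasure μ]

theorem integrable_norm_sub_sq (hR : IsMedianRecursion μ ν ℱ γ Y Z) (n : ℕ) :
    Integrable (fun ω => ‖Z n ω - m‖ ^ 2) μ := by
  obtain ⟨B, hB0, hB⟩ := hR.exists_ae_norm_sub_le m n
  have hZ := hR.measurable_iterate n
  refine Integrable.of_bound (by fun_prop) (B ^ 2) ?_
  filter_upwards [hB] with ω hω
  rw [Real.norm_of_nonneg (by positivity)]
  exact pow_le_pow_left₀ (norm_nonneg _) hω 2

theorem integrable_inner_unitDir (hR : IsMedianRecursion μ ν ℱ γ Y Z) (n : ℕ) :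
    Integrable (fun ω => inner ℝ (unitDir (Y n ω) (Z n ω)) (Z n ω - m)) μ := by
  obtain ⟨B, hB0, hB⟩ := hR.exists_ae_norm_sub_le m n
  refine Integrable.of_bound (hR.measurable_inner_unitDir m n).aestronglyMeasurable B ?_
  filter_upwards [hB] with ω hω
  exact (abs_inner_unitDir_le _ _ _).trans hω

theorem setIntegral_inner_unitDir_nonpos (hR : IsMedianRecursion μ ν ℱ γ Y Z)
    (hm : ∀ h : H, 0 ≤ ∫ x, (‖x - h‖ - ‖x - m‖) ∂ν) (n : ℕ) {A : Set Ω}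
    (hA : MeasurableSet[ℱ n] A) :
    ∫ ω in A, inner ℝ (unitDir (Y n ω) (Z n ω)) (Z n ω - m) ∂μ ≤ 0 := by
  have := hR.isProbabilityMeasure
  have hA' : MeasurableSet A := ℱ.le n _ hA
  have hone : Measurable[ℱ n] (A.indicator (fun _ => (1 : ℝ))) :=
    measurable_const.indicator hA
  have e : ∀ ω, A.indicator (fun ω => inner ℝ (unitDir (Y n ω) (Z n ω)) (Z n ω - m)) ω
      = A.indicator (fun _ => (1 : ℝ)) ω * inner ℝ (unitDir (Y n ω) (Z n ω)) (Z n ω - m) := by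
    intro ω
    by_cases h : ω ∈ A <;> simp [h]
  rw [← integral_indicator hA']
  have hint := (hR.integrable_inner_unitDir m n).indicator hA'
  rw [funext e] at hint ⊢
  have hφ : Measurable (Function.uncurry
      (fun (p : H × ℝ) (y : H) => p.2 * inner ℝ (unitDir y p.1) (p.1 - m))) := by
    have : Measurable fun q : (H × ℝ) × H => unitDir q.2 q.1.1 :=
      measurable_unitDir.comp (measurable_snd.prodMk measurable_fst.fst)
    exact measurable_fst.snd.mul (this.inner (measurable_fst.fst.sub_const m))
  -- The indicator of `A` joins `Z n` in the frozen state, so it leaves the inner integral as a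
  -- nonnegative constant.
  rw [integral_eq_integral_integral_of_indep (ℱ.le n)
    (S := fun ω => (Z n ω, A.indicator (fun _ => (1 : ℝ)) ω))
    (Measurable.prodMk (hR.adapted n) hone) (hR.measurable_obs n) (hR.indep n) (hR.map_eq n) hφ
    hint]
  refine integral_nonpos fun ω => ?_
  simp only [integral_const_mul, Pi.zero_apply]
  exact mul_nonpos_of_nonneg_of_nonpos (Set.indicator_nonneg (fun _ _ => zero_le_one) ω)
    (integral_inner_unitDir_nonpos ν m hm (Z n ω))

theorem supermartingale (hR : IsMedianRecursion μ ν ℱ γ Y Z)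
    (hm : ∀ h : H, 0 ≤ ∫ x, (‖x - h‖ - ‖x - m‖) ∂ν) :
    Supermartingale (fun n ω => ‖Z n ω - m‖ ^ 2 - ∑ k ∈ Finset.range n, γ k ^ 2) ℱ μ := by
  have hint : ∀ n, Integrable (fun ω => ‖Z n ω - m‖ ^ 2 - ∑ k ∈ Finset.range n, γ k ^ 2) μ :=
    fun n => (hR.integrable_norm_sub_sq m n).sub (integrable_const _)
  refine supermartingale_of_setIntegral_succ_le (fun n => ?_) hint fun n A hA => ?_
  · refine Measurable.stronglyMeasurable ?_
    exact Measurable.comp (g := fun z : H => ‖z - m‖ ^ 2 - ∑ k ∈ Finset.range n, γ k ^ 2)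
      (by fun_prop) (hR.adapted n)
  · have h1 := hR.setIntegral_inner_unitDir_nonpos m hm n hA
    have i1 := ((hR.integrable_inner_unitDir m n).const_mul (2 * γ n)).integrableOn (s := A)
    calc _ ≤ ∫ ω in A, ((‖Z n ω - m‖ ^ 2 - ∑ k ∈ Finset.range n, γ k ^ 2)
          + 2 * γ n * inner ℝ (unitDir (Y n ω) (Z n ω)) (Z n ω - m)) ∂μ := by
          refine integral_mono (hint (n + 1)).integrableOn ((hint n).integrableOn.add i1)
            fun ω => ?_
          have := hR.norm_sub_sq_succ_le m n ω
          simp only [Finset.sum_range_succ]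
          linarith
      _ = (∫ ω in A, (‖Z n ω - m‖ ^ 2 - ∑ k ∈ Finset.range n, γ k ^ 2) ∂μ)
          + 2 * γ n * ∫ ω in A, inner ℝ (unitDir (Y n ω) (Z n ω)) (Z n ω - m) ∂μ := by
          rw [integral_add (hint n).integrableOn i1, integral_const_mul]
      _ ≤ _ := by
          have := hR.step_nonneg n
          nlinarith

/-- The iterates are almost surely bounded. -/
theorem ae_exists_forall_norm_sub_le (hR : IsMedianRecursion μ ν ℱ γ Y Z)
    (hm : ∀ h : H, 0 ≤ ∫ x, (‖x - h‖ - ‖x - m‖) ∂ν) (hγ : Summable fun n => γ n ^ 2) :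
    ∀ᵐ ω ∂μ, ∃ R : ℕ, ∀ n, ‖Z n ω - m‖ ≤ R := by
  set Γ : ℝ := ∑' n, γ n ^ 2 with hΓ
  have hΓn : ∀ n, ∑ k ∈ Finset.range n, γ k ^ 2 ≤ Γ := fun n =>
    hγ.sum_le_tsum _ fun k _ => sq_nonneg _
  have hΓ0 : ∀ n, 0 ≤ ∑ k ∈ Finset.range n, γ k ^ 2 := fun n =>
    Finset.sum_nonneg fun k _ => sq_nonneg _
  set f : ℕ → Ω → ℝ := fun n ω => ‖Z n ω - m‖ ^ 2 - ∑ k ∈ Finset.range n, γ k ^ 2 with hf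
  have hsup : Supermartingale f ℱ μ := hR.supermartingale m hm
  have hE : ∀ n, ∫ ω, f n ω ∂μ ≤ ∫ ω, f 0 ω ∂μ := fun n => by
    simpa using hsup.setIntegral_le (Nat.zero_le n) MeasurableSet.univ
  have hbdd : ∀ n, eLpNorm ((-f) n) 1 μ ≤ (Real.toNNReal (∫ ω, f 0 ω ∂μ + 2 * Γ) : ℝ≥0) := by
    intro n
    have hi := hsup.integrable n
    have : eLpNorm ((-f) n) 1 μ = eLpNorm (f n) 1 μ := eLpNorm_neg _ _ _
    rw [this, eLpNorm_one_eq_lintegral_enorm, ← ofReal_integral_norm_eq_lintegral_enorm hi]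
    refine ENNReal.ofReal_le_ofReal ?_
    -- Holds because `f n ≥ -Γ`.
    calc ∫ ω, ‖f n ω‖ ∂μ ≤ ∫ ω, (f n ω + 2 * Γ) ∂μ := by
          refine integral_mono hi.norm (hi.add (integrable_const _)) fun ω => ?_
          simp only [Real.norm_eq_abs, abs_le, hf]
          have := sq_nonneg ‖Z n ω - m‖
          constructor <;> linarith [hΓn n, hΓ0 n]
      _ = ∫ ω, f n ω ∂μ + 2 * Γ := by rw [integral_add hi (integrable_const _)]; simp
      _ ≤ _ := by linarith [hE n]
  filter_upwards [hsup.neg.exists_ae_tendsto_of_bdd hbdd] with ω ⟨c, hc⟩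
  obtain ⟨b, hb⟩ := hc.bddBelow_range
  obtain ⟨R, hRn⟩ := exists_nat_ge (√(Γ - b))
  refine ⟨R, fun n => le_trans (Real.le_sqrt_of_sq_le ?_) hRn⟩
  have := hb ⟨n, rfl⟩
  simp only [Pi.neg_apply, hf] at this
  linarith [hΓn n]

end IsMedianRecursion

end Recursion

/-! ### One-step exponential estimates -/

section Exponential

/-- **Hoeffding's lemma** for a random variable that need not be centred. -/
theorem mgf_le_exp_of_abs_le {E : Type*} [MeasurableSpace E] {ν : Measure E}
    [IsProbabilityMeasure ν] {f : E → ℝ} (hf : AEMeasurable f ν) {r : ℝ} (hr : 0 ≤ r)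
    (hfr : ∀ x, |f x| ≤ r) (t : ℝ) :
    mgf f ν t ≤ Real.exp (t * ∫ x, f x ∂ν + r ^ 2 * t ^ 2 / 2) := by
  have h := (hasSubgaussianMGF_of_mem_Icc (a := -r) (b := r) hf
    (ae_of_all _ fun x => abs_le.1 (hfr x))).mgf_le t
  have e₁ : (((‖r - -r‖₊ / 2) ^ 2 : ℝ≥0) : ℝ) = r ^ 2 := by
    simp only [NNReal.coe_pow, NNReal.coe_div, coe_nnnorm, NNReal.coe_ofNat]
    rw [Real.norm_of_nonneg (by linarith)]; ring
  have e₂ : mgf f ν t = Real.exp (t * ∫ x, f x ∂ν) * mgf (fun x => f x - ∫ x, f x ∂ν) ν t := by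
    simp only [mgf]
    rw [← integral_const_mul]
    refine integral_congr_ae (ae_of_all _ fun x => ?_)
    simp only [← Real.exp_add]
    ring_nf
  rw [e₁] at h
  rw [e₂, Real.exp_add]
  exact mul_le_mul_of_nonneg_left h (Real.exp_nonneg _)

/-- Young's inequality for the exponential function. -/
theorem exp_one_sub_mul_le {d : ℝ} (hd0 : 0 ≤ d) (hd1 : d ≤ 1) (x K : ℝ) :
    Real.exp ((1 - d) * x) ≤ Real.exp (-(d * K)) * ((1 - d) * Real.exp x + d * Real.exp K) := by
  have h := convexOn_exp.2 (Set.mem_univ x) (Set.mem_univ K) (sub_nonneg.2 hd1) hd0 (by ring)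
  simp only [smul_eq_mul] at h
  calc Real.exp ((1 - d) * x) = Real.exp (-(d * K)) * Real.exp ((1 - d) * x + d * K) := by
        rw [← Real.exp_add]; ring_nf
    _ ≤ _ := mul_le_mul_of_nonneg_left h (Real.exp_nonneg _)

variable {H : Type*} [NormedAddCommGroup H] [InnerProductSpace ℝ H]
  [MeasurableSpace H] [BorelSpace H] [SecondCountableTopology H]

/-- Expanding the square leaves a random term linear in `f x = ⟨unitDir x z, z - m⟩`, which is
bounded by `‖z - m‖`. Hoeffding's lemma at `t = 2sg` yields the drift and a correction `2s²g²‖z -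
m‖²`, both multiples of `‖z - m‖²`. -/
theorem integral_exp_norm_sub_sq_le {ν : Measure H} [IsProbabilityMeasure ν] (m z : H) {k : ℝ}
    (hk : ∫ x, inner ℝ (unitDir x z) (z - m) ∂ν ≤ -(k * ‖z - m‖ ^ 2)) {s g : ℝ} (hs : 0 ≤ s)
    (hg : 0 ≤ g) :
    ∫ x, Real.exp (s * ‖z + g • unitDir x z - m‖ ^ 2) ∂ν ≤
      Real.exp (s * g ^ 2) *
        Real.exp (s * (1 - 2 * g * k + 2 * s * g ^ 2) * ‖z - m‖ ^ 2) := by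
  set f : H → ℝ := fun x => inner ℝ (unitDir x z) (z - m) with hf
  have hfm : Measurable f := by
    have : Measurable fun x : H => unitDir x z :=
      measurable_unitDir.comp (measurable_id.prodMk measurable_const)
    exact this.inner measurable_const
  have hfr : ∀ x, |f x| ≤ ‖z - m‖ := fun x => abs_inner_unitDir_le x z (z - m)
  have hmgf := mgf_le_exp_of_abs_le (ν := ν) hfm.aemeasurable (norm_nonneg _) hfr (2 * s * g)
  have hexp : Integrable (fun x => Real.exp (2 * s * g * f x)) ν :=
    integrable_exp_mul_of_mem_Icc hfm.aemeasurable (ae_of_all _ fun x => abs_le.1 (hfr x))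
  calc ∫ x, Real.exp (s * ‖z + g • unitDir x z - m‖ ^ 2) ∂ν
      ≤ ∫ x, Real.exp (s * (‖z - m‖ ^ 2 + g ^ 2)) * Real.exp (2 * s * g * f x) ∂ν := by
        refine integral_mono_of_nonneg (ae_of_all _ fun x => Real.exp_nonneg _)
          (hexp.const_mul _) (ae_of_all _ fun x => ?_)
        simp only
        rw [← Real.exp_add, Real.exp_le_exp]
        have e : z + g • unitDir x z - m = (z - m) + g • unitDir x z := by abel
        have h1 := pow_le_pow_left₀ (norm_nonneg _) (norm_unitDir_le x z) 2
        have h2 : ‖z + g • unitDir x z - m‖ ^ 2 ≤ ‖z - m‖ ^ 2 + 2 * g * f x + g ^ 2 := by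
          rw [e, norm_add_sq_real, real_inner_smul_right, norm_smul, real_inner_comm, mul_pow,
            Real.norm_eq_abs, sq_abs]
          nlinarith [mul_le_mul_of_nonneg_left h1 (sq_nonneg g)]
        nlinarith [mul_le_mul_of_nonneg_left h2 hs]
    _ = Real.exp (s * (‖z - m‖ ^ 2 + g ^ 2)) * mgf f ν (2 * s * g) := by
        rw [integral_const_mul, mgf]
    _ ≤ Real.exp (s * (‖z - m‖ ^ 2 + g ^ 2)) *
          Real.exp (2 * s * g * ∫ x, f x ∂ν + ‖z - m‖ ^ 2 * (2 * s * g) ^ 2 / 2) :=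
        mul_le_mul_of_nonneg_left hmgf (Real.exp_nonneg _)
    _ ≤ _ := by
        rw [← Real.exp_add, ← Real.exp_add, Real.exp_le_exp]
        nlinarith [mul_le_mul_of_nonneg_left hk (mul_nonneg hs hg)]

end Exponential

/-! ### Exponential moments of the killed process -/

section Killed

/-- The squared distance to `m`, killed when the process leaves the ball of radius `R`. -/
noncomputable def killedSq {H Ω : Type*} [NormedAddCommGroup H] (Z : ℕ → Ω → H) (m : H) (R : ℝ)
    (n : ℕ) : Ω → ℝ :=
  {ω | ∀ k ≤ n, ‖Z k ω - m‖ ≤ R}.indicator fun ω => ‖Z n ω - m‖ ^ 2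

theorem killedSq_of_forall_le {H Ω : Type*} [NormedAddCommGroup H] {Z : ℕ → Ω → H} {m : H}
    {R : ℝ} {n : ℕ} {ω : Ω} (h : ∀ k ≤ n, ‖Z k ω - m‖ ≤ R) :
    killedSq Z m R n ω = ‖Z n ω - m‖ ^ 2 :=
  Set.indicator_of_mem (s := {ω | ∀ k ≤ n, ‖Z k ω - m‖ ≤ R}) h _

theorem killedSq_nonneg {H Ω : Type*} [NormedAddCommGroup H] (Z : ℕ → Ω → H) (m : H) (R : ℝ)
    (n : ℕ) (ω : Ω) : 0 ≤ killedSq Z m R n ω :=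
  Set.indicator_nonneg (fun _ _ => sq_nonneg _) ω

theorem killedSq_le {H Ω : Type*} [NormedAddCommGroup H] (Z : ℕ → Ω → H) (m : H) (R : ℝ)
    (n : ℕ) (ω : Ω) : killedSq Z m R n ω ≤ R ^ 2 :=
  Set.indicator_apply_le' (fun h => pow_le_pow_left₀ (norm_nonneg _) (h n le_rfl) 2)
    fun _ => sq_nonneg R

end Killed

namespace IsMedianRecursion

variable {H : Type*} [NormedAddCommGroup H] [InnerProductSpace ℝ H]
  [MeasurableSpace H] [BorelSpace H]
  {Ω : Type*} [mΩ : MeasurableSpace Ω]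
  {μ : Measure Ω} {ν : Measure H} {ℱ : Filtration ℕ mΩ} {γ : ℕ → ℝ} {Y Z : ℕ → Ω → H}

theorem measurableSet_forall_norm_sub_le (hR : IsMedianRecursion μ ν ℱ γ Y Z) (m : H) (R : ℝ)
    (n : ℕ) : MeasurableSet[ℱ n] {ω | ∀ k ≤ n, ‖Z k ω - m‖ ≤ R} := by
  have e : {ω | ∀ k ≤ n, ‖Z k ω - m‖ ≤ R} =
      ⋂ k, ⋂ (_ : k ≤ n), Z k ⁻¹' {z | ‖z - m‖ ≤ R} := by
    ext ω; simp
  rw [e]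
  refine MeasurableSet.iInter fun k => MeasurableSet.iInter fun hk => ?_
  refine ℱ.mono hk _ (hR.adapted k ?_)
  exact measurableSet_le (by fun_prop) (by fun_prop)

theorem measurable_killedSq (hR : IsMedianRecursion μ ν ℱ γ Y Z) (m : H) (R : ℝ) (n : ℕ) :
    Measurable (killedSq Z m R n) :=
  (((hR.measurable_iterate n).sub_const m).norm.pow_const 2).indicator
    (ℱ.le n _ (hR.measurableSet_forall_norm_sub_le m R n))

variable [IsProbabilityMeasure μ]

theorem integrable_exp_mul_killedSq (hR : IsMedianRecursion μ ν ℱ γ Y Z) (m : H) (R : ℝ) (n : ℕ)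
    (s : ℝ) : Integrable (fun ω => Real.exp (s * killedSq Z m R n ω)) μ :=
  integrable_exp_mul_of_mem_Icc (a := 0) (b := R ^ 2) (hR.measurable_killedSq m R n).aemeasurable
    (ae_of_all _ fun ω => ⟨killedSq_nonneg Z m R n ω, killedSq_le Z m R n ω⟩)

/-- Bounded exponential moments yield an almost sure rate of the killed squared distance. -/
theorem ae_eventually_killedSq_lt (hR : IsMedianRecursion μ ν ℱ γ Y Z) (m : H) {R C : ℝ}
    {s t : ℕ → ℝ} (hs : ∀ n, 0 ≤ s n) {N : ℕ}
    (hC : ∀ n ≥ N, ∫ ω, Real.exp (s n * killedSq Z m R n ω) ∂μ ≤ Real.exp C)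
    (hst : Summable fun n => Real.exp (-(s n * t n))) :
    ∀ᵐ ω ∂μ, ∀ᶠ n in atTop, killedSq Z m R n ω < t n := by
  have htail : ∀ n, μ {ω | t (n + N) ≤ killedSq Z m R (n + N) ω} ≤
      ENNReal.ofReal (Real.exp C * Real.exp (-(s (n + N) * t (n + N)))) := by
    intro n
    rw [← ofReal_measureReal]
    refine ENNReal.ofReal_le_ofReal ?_
    refine (measure_ge_le_exp_mul_mgf (t (n + N)) (hs (n + N))
      (hR.integrable_exp_mul_killedSq m R (n + N) _)).trans ?_
    rw [mul_comm, neg_mul]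
    exact mul_le_mul_of_nonneg_right (hC _ (Nat.le_add_left _ _)) (Real.exp_nonneg _)
  have hsum : Summable fun n => Real.exp C * Real.exp (-(s (n + N) * t (n + N))) :=
    ((summable_nat_add_iff N).2 hst).mul_left _
  have := ae_eventually_notMem (ne_top_of_le_ne_top hsum.tsum_ofReal_ne_top
    (ENNReal.tsum_le_tsum htail))
  filter_upwards [this] with ω hω
  rw [← map_add_atTop_eq_nat N, eventually_map]
  filter_upwards [hω] with n hn
  simpa using hn

variable [SecondCountableTopology H]

/-- The survival event up to time `n` lies in the past, and on it the drift bound for the ball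
applies. Survival at time `n + 1` can be dropped, as this only increases the integrand. -/
theorem integral_exp_mul_killedSq_succ_le (hR : IsMedianRecursion μ ν ℱ γ Y Z) (m : H) {R k : ℝ}
    (hk : ∀ z : H, ‖z - m‖ ≤ R →
      ∫ x, inner ℝ (unitDir x z) (z - m) ∂ν ≤ -(k * ‖z - m‖ ^ 2)) {s : ℝ} (hs : 0 ≤ s) (n : ℕ) :
    ∫ ω, Real.exp (s * killedSq Z m R (n + 1) ω) ∂μ ≤ Real.exp (s * γ n ^ 2) *
      ∫ ω, Real.exp (s * (1 - 2 * γ n * k + 2 * s * γ n ^ 2) * killedSq Z m R n ω) ∂μ := by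
  have := hR.isProbabilityMeasure
  set A : Set Ω := {ω | ∀ k ≤ n, ‖Z k ω - m‖ ≤ R} with hA
  have hAm : MeasurableSet[ℱ n] A := hR.measurableSet_forall_norm_sub_le m R n
  have hone : Measurable[ℱ n] (A.indicator (fun _ => (1 : ℝ))) :=
    measurable_const.indicator hAm
  set φ : H × ℝ → H → ℝ := fun p y =>
    Real.exp (s * (p.2 * ‖p.1 + γ n • unitDir y p.1 - m‖ ^ 2)) with hφ
  have hφm : Measurable (Function.uncurry φ) := by
    have : Measurable fun q : (H × ℝ) × H => unitDir q.2 q.1.1 :=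
      measurable_unitDir.comp (measurable_snd.prodMk measurable_fst.fst)
    simp only [hφ, Function.uncurry_def]
    fun_prop
  have hφZ : ∀ ω, φ (Z n ω, A.indicator (fun _ => (1 : ℝ)) ω) (Y n ω)
      = Real.exp (s * (A.indicator (fun _ => (1 : ℝ)) ω * ‖Z (n + 1) ω - m‖ ^ 2)) := by
    intro ω; rw [hR.step]
  have hint : Integrable
      (fun ω => φ (Z n ω, A.indicator (fun _ => (1 : ℝ)) ω) (Y n ω)) μ := by
    simp_rw [hφZ]
    obtain ⟨B, hB0, hB⟩ := hR.exists_ae_norm_sub_le m (n + 1)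
    have hZ := hR.measurable_iterate (n + 1)
    have hone' : Measurable (A.indicator (fun _ => (1 : ℝ))) := hone.mono (ℱ.le n) le_rfl
    refine Integrable.of_bound (by fun_prop) (Real.exp (s * B ^ 2)) ?_
    filter_upwards [hB] with ω hω
    rw [Real.norm_of_nonneg (Real.exp_nonneg _), Real.exp_le_exp]
    refine mul_le_mul_of_nonneg_left ?_ hs
    have h1 := pow_le_pow_left₀ (norm_nonneg _) hω 2
    by_cases h : ω ∈ A
    · simpa [h] using h1
    · simpa [h] using sq_nonneg B
  calc ∫ ω, Real.exp (s * killedSq Z m R (n + 1) ω) ∂μ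
      ≤ ∫ ω, φ (Z n ω, A.indicator (fun _ => (1 : ℝ)) ω) (Y n ω) ∂μ := by
        refine integral_mono (hR.integrable_exp_mul_killedSq m R (n + 1) s) hint fun ω => ?_
        simp only [hφZ]
        rw [Real.exp_le_exp]
        refine mul_le_mul_of_nonneg_left ?_ hs
        refine Set.indicator_apply_le' (fun h => ?_) fun _ => ?_
        · have : ω ∈ A := fun k hk => h k (hk.trans n.le_succ)
          simp [this]
        · exact mul_nonneg (Set.indicator_nonneg (fun _ _ => zero_le_one) ω) (sq_nonneg _)
    _ = ∫ ω, ∫ y, φ (Z n ω, A.indicator (fun _ => (1 : ℝ)) ω) y ∂ν ∂μ :=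
        integral_eq_integral_integral_of_indep (ℱ.le n)
          (S := fun ω => (Z n ω, A.indicator (fun _ => (1 : ℝ)) ω))
          (Measurable.prodMk (hR.adapted n) hone) (hR.measurable_obs n) (hR.indep n)
          (hR.map_eq n) hφm hint
    _ ≤ ∫ ω, Real.exp (s * γ n ^ 2) *
          Real.exp (s * (1 - 2 * γ n * k + 2 * s * γ n ^ 2) * killedSq Z m R n ω) ∂μ := by
        refine integral_mono_of_nonneg
          (ae_of_all _ fun ω => integral_nonneg fun y => Real.exp_nonneg _)
          ((hR.integrable_exp_mul_killedSq m R n _).const_mul _) (ae_of_all _ fun ω => ?_)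
        simp only [hφ]
        by_cases h : ω ∈ A
        · rw [killedSq_of_forall_le h]
          simpa [h] using integral_exp_norm_sub_sq_le m (Z n ω) (hk _ (h n le_rfl)) hs
            (hR.step_nonneg n)
        -- After killing, both exponents in the killed distance vanish, and the remaining factor is
        -- at least `1`.
        · have h0 : killedSq Z m R n ω = 0 := Set.indicator_of_notMem h _
          have : 0 ≤ s * γ n ^ 2 := by positivity
          simpa [h, h0] using this
    _ = _ := integral_const_mul _ _

/-- Exponential moments of the rescaled killed squared distance stay bounded. -/
theorem exists_integral_exp_mul_killedSq_le (hR : IsMedianRecursion μ ν ℱ γ Y Z) (m : H)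
    {R k : ℝ} (hk : ∀ z : H, ‖z - m‖ ≤ R →
      ∫ x, inner ℝ (unitDir x z) (z - m) ∂ν ≤ -(k * ‖z - m‖ ^ 2)) {s d : ℕ → ℝ} {K : ℝ} {N : ℕ}
    (hs : ∀ n, 0 ≤ s n) (hd : ∀ n ≥ N, 0 ≤ d n ∧ d n ≤ 1)
    (hsd : ∀ n ≥ N,
      s (n + 1) * (1 - 2 * γ n * k + 2 * s (n + 1) * γ n ^ 2) ≤ (1 - d n) * s n)
    (hK : ∀ n ≥ N, s (n + 1) * γ n ^ 2 ≤ d n * K) :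
    ∃ C : ℝ, ∀ n ≥ N, ∫ ω, Real.exp (s n * killedSq Z m R n ω) ∂μ ≤ Real.exp C := by
  -- The second entry starts the induction, as the killed square is at most `R ^ 2`. The first
  -- closes it: Young's inequality gains a factor `exp (-(d n * C))`, which pays for the noise term
  -- `exp (d n * K)`.
  refine ⟨max K (s N * R ^ 2), fun n hn => ?_⟩
  set C := max K (s N * R ^ 2) with hC
  induction n, hn using Nat.le_induction with
  | base =>
    calc ∫ ω, Real.exp (s N * killedSq Z m R N ω) ∂μ ≤ ∫ _, Real.exp C ∂μ := by
          refine integral_mono (hR.integrable_exp_mul_killedSq m R N _) (integrable_const _)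
            fun ω => Real.exp_le_exp.2 ?_
          exact (mul_le_mul_of_nonneg_left (killedSq_le Z m R N ω) (hs N)).trans
            (le_max_right _ _)
      _ = _ := by simp
  | succ n hn ih =>
    obtain ⟨hd0, hd1⟩ := hd n hn
    have i1 := hR.integrable_exp_mul_killedSq m R n (s n)
    have h1 : ∫ ω, Real.exp (s (n + 1) * (1 - 2 * γ n * k + 2 * s (n + 1) * γ n ^ 2)
        * killedSq Z m R n ω) ∂μ ≤ Real.exp (-(d n * C)) * Real.exp C := by
      calc _ ≤ ∫ ω, Real.exp (-(d n * C)) *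
              ((1 - d n) * Real.exp (s n * killedSq Z m R n ω) + d n * Real.exp C) ∂μ := by
            refine integral_mono (hR.integrable_exp_mul_killedSq m R n _)
              (((i1.const_mul _).add (integrable_const _)).const_mul _) fun ω => ?_
            refine le_trans (Real.exp_le_exp.2 ?_) (exp_one_sub_mul_le hd0 hd1 _ C)
            rw [← mul_assoc]
            exact mul_le_mul_of_nonneg_right (hsd n hn) (killedSq_nonneg Z m R n ω)
        _ = Real.exp (-(d n * C)) *
              ((1 - d n) * ∫ ω, Real.exp (s n * killedSq Z m R n ω) ∂μ + d n * Real.exp C) := by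
            rw [integral_const_mul, integral_add (i1.const_mul _) (integrable_const _),
              integral_const_mul]
            simp
        _ ≤ _ := by
            refine mul_le_mul_of_nonneg_left ?_ (Real.exp_nonneg _)
            nlinarith [mul_le_mul_of_nonneg_left ih (sub_nonneg.2 hd1)]
    refine (hR.integral_exp_mul_killedSq_succ_le m hk (hs (n + 1)) n).trans ?_
    refine (mul_le_mul_of_nonneg_left h1 (Real.exp_nonneg _)).trans ?_
    rw [← Real.exp_add, ← Real.exp_add, Real.exp_le_exp]
    have := mul_le_mul_of_nonneg_left (le_max_left K (s N * R ^ 2)) hd0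
    linarith [hK n hn]

end IsMedianRecursion

/-! ### Polynomial step sizes and the rate -/

section StepSize

theorem tendsto_natCast_add_one_rpow_neg {p : ℝ} (hp : 0 < p) :
    Tendsto (fun n : ℕ => ((n : ℝ) + 1) ^ (-p)) atTop (𝓝 0) :=
  (tendsto_rpow_neg_atTop hp).comp
    (tendsto_atTop_add_const_right atTop (1 : ℝ) tendsto_natCast_atTop_atTop)

theorem summable_exp_neg_mul_natCast_add_one_rpow {a p : ℝ} (ha : 0 < a) (hp : 0 < p) :
    Summable fun n : ℕ => Real.exp (-(a * ((n : ℝ) + 1) ^ p)) := by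
  have h : Summable fun n : ℕ => Real.exp (-(a * (n : ℝ) ^ p)) := by
    refine summable_of_isBigO_nat (Real.summable_nat_rpow.2 (by norm_num : (-2 : ℝ) < -1)) ?_
    -- The exponent `-2 / p` in the variable `n ^ p` amounts to comparison with `n ^ (-2)`.
    have h1 := ((isLittleO_exp_neg_mul_rpow_atTop ha (-2 / p)).comp_tendsto
      ((tendsto_rpow_atTop hp).comp tendsto_natCast_atTop_atTop)).isBigO
    refine h1.congr (fun n => ?_) fun n => ?_
    · simp [neg_mul]
    · simp only [Function.comp_apply]
      rw [← Real.rpow_mul (Nat.cast_nonneg n), mul_div_cancel₀ _ hp.ne']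
  simpa using (summable_nat_add_iff 1).2 h

theorem natCast_add_two_rpow_le {α : ℝ} (hα : α ≤ 1) (n : ℕ) :
    ((n : ℝ) + 2) ^ α ≤ ((n : ℝ) + 1) ^ α * (1 + 1 / ((n : ℝ) + 1)) := by
  have h1 : (1 : ℝ) ≤ 1 + 1 / ((n : ℝ) + 1) := by
    have : (0 : ℝ) ≤ 1 / ((n : ℝ) + 1) := by positivity
    linarith
  have e : (n : ℝ) + 2 = ((n : ℝ) + 1) * (1 + 1 / ((n : ℝ) + 1)) := by field_simp; ring
  rw [e, Real.mul_rpow (by positivity) (by positivity)]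
  refine mul_le_mul_of_nonneg_left ?_ (by positivity)
  simpa using Real.rpow_le_rpow_of_exponent_le h1 hα

end StepSize

namespace IsMedianRecursion

variable {H : Type*} [NormedAddCommGroup H] [InnerProductSpace ℝ H]
  [MeasurableSpace H] [BorelSpace H] [SecondCountableTopology H]
  {Ω : Type*} [mΩ : MeasurableSpace Ω] {μ : Measure Ω} [IsProbabilityMeasure μ]
  {ν : Measure H} {ℱ : Filtration ℕ mΩ} {Y Z : ℕ → Ω → H}

/-- With `s n` of order `n ^ α`, the product `s n * n ^ (-β)` is of order `n ^ (α - β)`, so the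
Chernoff tails are summable. -/
theorem ae_eventually_killedSq_lt_rpow {c α : ℝ} (hc : 0 < c) (hα0 : 0 < α) (hα1 : α < 1)
    (hR : IsMedianRecursion μ ν ℱ (fun n => c * ((n : ℝ) + 1) ^ (-α)) Y Z) (m : H)
    {R k : ℝ} (hk0 : 0 < k) (hk : ∀ z : H, ‖z - m‖ ≤ R →
      ∫ x, inner ℝ (unitDir x z) (z - m) ∂ν ≤ -(k * ‖z - m‖ ^ 2)) {β : ℝ} (hβ : β < α) :
    ∀ᵐ ω ∂μ, ∀ᶠ n : ℕ in atTop, killedSq Z m R n ω < ((n : ℝ) + 1) ^ (-β) := by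
  -- Chosen with `d n = k γₙ / 2` so that the contraction `2kγₙ = 4 d n` loses at most `2 d n` to
  -- the Hoeffding correction and, since `α < 1`, eventually another `d n` to the growth of `s`: `(1
  -- + d)(1 - 2d) ≤ 1 - d`.
  set a : ℝ := k / (4 * c) with ha
  have ha0 : 0 < a := by positivity
  set s : ℕ → ℝ := fun n => a * ((n : ℝ) + 1) ^ α with hs
  set d : ℕ → ℝ := fun n => k * c / 2 * ((n : ℝ) + 1) ^ (-α) with hd
  have hs0 : ∀ n, 0 ≤ s n := fun n => by positivity
  have hd0 : ∀ n, 0 ≤ d n := fun n => by positivity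
  have ev₁ : ∀ᶠ n : ℕ in atTop, d n ≤ 1 / 2 := by
    have h := (tendsto_natCast_add_one_rpow_neg hα0).const_mul (k * c / 2)
    rw [mul_zero] at h
    exact h.eventually_le_const (by norm_num)
  have ev₂ : ∀ᶠ n : ℕ in atTop, 1 / ((n : ℝ) + 1) ≤ d n := by
    have h := (tendsto_natCast_add_one_rpow_neg (sub_pos.2 hα1))
    filter_upwards [h.eventually_le_const (show (0 : ℝ) < k * c / 2 by positivity)] with n hn
    have hn1 : (0 : ℝ) < (n : ℝ) + 1 := by positivity
    have e : 1 / ((n : ℝ) + 1) = ((n : ℝ) + 1) ^ (-(1 - α)) * ((n : ℝ) + 1) ^ (-α) := by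
      rw [← Real.rpow_add hn1, one_div, ← Real.rpow_neg_one]; congr 1; ring
    rw [e]
    exact mul_le_mul_of_nonneg_right hn (by positivity)
  obtain ⟨N, hN⟩ := eventually_atTop.1 (ev₁.and ev₂)
  have hquad : ∀ n, s (n + 1) * (c * ((n : ℝ) + 1) ^ (-α)) ^ 2 ≤ d n := by
    intro n
    have h1 := natCast_add_two_rpow_le hα1.le n
    have h2 : 1 / ((n : ℝ) + 1) ≤ 1 := by
      rw [div_le_one (by positivity)]; linarith [(Nat.cast_nonneg n : (0 : ℝ) ≤ n)]
    have hp : 0 < ((n : ℝ) + 1) ^ α := by positivity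
    have h3 : ((n : ℝ) + 2) ^ α ≤ ((n : ℝ) + 1) ^ α * 2 :=
      h1.trans (mul_le_mul_of_nonneg_left (by linarith) hp.le)
    have e2 : ((n + 1 : ℕ) : ℝ) + 1 = (n : ℝ) + 2 := by push_cast; ring
    simp only [hs, hd, e2, ha]
    rw [Real.rpow_neg (by positivity)]
    calc _ ≤ k / (4 * c) * (((n : ℝ) + 1) ^ α * 2) * (c * (((n : ℝ) + 1) ^ α)⁻¹) ^ 2 := by gcongr
      _ = _ := by field_simp; ring
  obtain ⟨C, hC⟩ := hR.exists_integral_exp_mul_killedSq_le m hk (s := s) (d := d) (K := 1)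
    (N := N) hs0 (fun n hn => ⟨hd0 n, (hN n hn).1.trans (by norm_num)⟩) (fun n hn => by
      obtain ⟨hn1, hn2⟩ := hN n hn
      have hp : 0 < ((n : ℝ) + 1) ^ α := by positivity
      have h1 : s (n + 1) ≤ s n * (1 + d n) := by
        have e2 : ((n + 1 : ℕ) : ℝ) + 1 = (n : ℝ) + 2 := by push_cast; ring
        simp only [hs, e2]
        rw [mul_assoc]
        refine mul_le_mul_of_nonneg_left ?_ ha0.le
        exact (natCast_add_two_rpow_le hα1.le n).trans
          (mul_le_mul_of_nonneg_left (by linarith) hp.le)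
      have h2 : 1 - 2 * (c * ((n : ℝ) + 1) ^ (-α)) * k
          + 2 * s (n + 1) * (c * ((n : ℝ) + 1) ^ (-α)) ^ 2 ≤ 1 - 2 * d n := by
        have := hquad n
        have e : 2 * (c * ((n : ℝ) + 1) ^ (-α)) * k = 4 * d n := by simp only [hd]; ring
        rw [e]; linarith
      calc _ ≤ s (n + 1) * (1 - 2 * d n) := mul_le_mul_of_nonneg_left h2 (hs0 _)
        _ ≤ s n * (1 + d n) * (1 - 2 * d n) := mul_le_mul_of_nonneg_right h1 (by linarith)
        _ ≤ _ := by nlinarith [mul_nonneg (hs0 n) (sq_nonneg (d n))])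
    (fun n _ => by simpa using hquad n)
  refine hR.ae_eventually_killedSq_lt m hs0 hC ?_
  have e : ∀ n : ℕ, s n * ((n : ℝ) + 1) ^ (-β) = a * ((n : ℝ) + 1) ^ (α - β) := fun n => by
    rw [mul_assoc, ← Real.rpow_add (by positivity), sub_eq_add_neg]
  simp_rw [e]
  exact summable_exp_neg_mul_natCast_add_one_rpow ha0 (sub_pos.2 hβ)

/-- The almost sure rate of convergence of the stochastic gradient algorithm. -/
theorem ae_eventually_norm_sub_sq_lt_rpow [CompleteSpace H] {c α : ℝ} (hc : 0 < c)
    (hα : α ∈ Set.Ioo (1 / 2 : ℝ) 1)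
    (hR : IsMedianRecursion μ ν ℱ (fun n => c * ((n : ℝ) + 1) ^ (-α)) Y Z) (m : H)
    (hA : ∀ h : H, ∃ h' : H, inner ℝ h h' = 0 ∧ h' ∉ aeOrthogonal ν m)
    (hm : ∀ h : H, 0 ≤ ∫ x, (‖x - h‖ - ‖x - m‖) ∂ν) {β : ℝ} (hβ : β < α) :
    ∀ᵐ ω ∂μ, ∀ᶠ n : ℕ in atTop, ‖Z n ω - m‖ ^ 2 < ((n : ℝ) + 1) ^ (-β) := by
  have := hR.isProbabilityMeasure
  have hγ : Summable fun n : ℕ => (c * ((n : ℝ) + 1) ^ (-α)) ^ 2 := by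
    have h : Summable fun n : ℕ => c ^ 2 * (n : ℝ) ^ (-(2 * α)) :=
      (Real.summable_nat_rpow.2 (by linarith [hα.1])).mul_left _
    refine ((summable_nat_add_iff 1).2 h).congr fun n => ?_
    rw [mul_pow, ← Real.rpow_natCast (((n : ℝ) + 1) ^ (-α)), ← Real.rpow_mul (by positivity)]
    push_cast
    ring_nf
  have hrate : ∀ᵐ ω ∂μ, ∀ R : ℕ, ∀ᶠ n : ℕ in atTop,
      killedSq Z m (R + 1) n ω < ((n : ℝ) + 1) ^ (-β) := by
    refine ae_all_iff.2 fun R => ?_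
    -- The constant `k` depends on the radius but the rate does not; `R + 1` keeps the radius
    -- positive, and countably many radii suffice.
    obtain ⟨k, hk0, hk⟩ := exists_pos_integral_inner_unitDir_le ν m hA hm
      (R := (R : ℝ) + 1) (by positivity)
    exact hR.ae_eventually_killedSq_lt_rpow hc (by linarith [hα.1]) hα.2 m hk0 hk hβ
  filter_upwards [hrate, hR.ae_exists_forall_norm_sub_le m hm hγ] with ω hω ⟨R, hRω⟩
  filter_upwards [hω R] with n hn
  rwa [killedSq_of_forall_le fun k _ => (hRω k).trans (by linarith)] at hn

end IsMedianRecursion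

/-! ### The natural filtration of the algorithm -/

section History

variable {H Ω : Type*} [MeasurableSpace H] [mΩ : MeasurableSpace Ω]

/-- The filtration generated by an initial value and the first observations. -/
def historyFiltration {Z₀ : Ω → H} {Y : ℕ → Ω → H} (hZ₀ : Measurable Z₀)
    (hY : ∀ n, Measurable (Y n)) : Filtration ℕ mΩ where
  seq n := MeasurableSpace.comap (fun ω => (Z₀ ω, fun i : Fin n => Y i ω)) inferInstance
  mono' := by
    intro a b hab
    have hg : Measurable fun p : H × (Fin b → H) =>
        (p.1, fun i : Fin a => p.2 (Fin.castLE hab i)) := by fun_prop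
    exact (hg.comp (comap_measurable fun ω => (Z₀ ω, fun i : Fin b => Y i ω))).comap_le
  le' n := (hZ₀.prodMk (measurable_pi_lambda _ fun i : Fin n => hY i)).comap_le

theorem measurable_history {Z₀ : Ω → H} {Y : ℕ → Ω → H} (hZ₀ : Measurable Z₀)
    (hY : ∀ n, Measurable (Y n)) (n : ℕ) :
    Measurable[historyFiltration hZ₀ hY n] fun ω => (Z₀ ω, fun i : Fin n => Y i ω) :=
  comap_measurable _

theorem indep_historyFiltration {μ : Measure Ω} [IsProbabilityMeasure μ] {Z₀ : Ω → H}
    {Y : ℕ → Ω → H} (hZ₀ : Measurable Z₀) (hY : ∀ n, Measurable (Y n)) (hind : iIndepFun Y μ)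
    (hZY : IndepFun Z₀ (fun ω n => Y n ω) μ) (n : ℕ) :
    Indep (historyFiltration hZ₀ hY n) (MeasurableSpace.comap (Y n) inferInstance) μ := by
  refine (IndepFun_iff_Indep (fun ω => (Z₀ ω, fun i : Fin n => Y i ω)) (Y n) μ).1 ?_
  refine indepFun_prodMk_left_of_prodMk_right hZ₀ (measurable_pi_lambda _ fun i : Fin n => hY i)
    (hY n) ?_ ?_
  · exact hZY.comp (φ := id) (ψ := fun y : ℕ → H => (fun i : Fin n => y i, y n)) measurable_id
      (by fun_prop)
  · have h := hind.indepFun_finset (Finset.range n) {n} (by simp) hY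
    exact h.comp (φ := fun y (i : Fin n) => y ⟨i, Finset.mem_range.2 i.2⟩)
      (ψ := fun y : ({n} : Finset ℕ) → H => y ⟨n, Finset.mem_singleton_self n⟩)
      (by fun_prop)
      (measurable_pi_apply (X := fun _ : ({n} : Finset ℕ) => H) ⟨n, Finset.mem_singleton_self n⟩)

end History

theorem measurable_historyFiltration_of_step {H Ω : Type*} [NormedAddCommGroup H]
    [InnerProductSpace ℝ H] [MeasurableSpace H] [BorelSpace H] [SecondCountableTopology H]
    [mΩ : MeasurableSpace Ω] {γ : ℕ → ℝ} {Y Z : ℕ → Ω → H} (hZ₀ : Measurable (Z 0))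
    (hY : ∀ n, Measurable (Y n))
    (hstep : ∀ n ω, Z (n + 1) ω = Z n ω + γ n • unitDir (Y n ω) (Z n ω)) (n : ℕ) :
    Measurable[historyFiltration hZ₀ hY n] (Z n) := by
  induction n with
  | zero => exact measurable_fst.comp (measurable_history hZ₀ hY 0)
  | succ n ih =>
    have h₁ : Measurable[historyFiltration hZ₀ hY (n + 1)] (Z n) :=
      ih.mono ((historyFiltration hZ₀ hY).mono n.le_succ) le_rfl
    have h₂ : Measurable[historyFiltration hZ₀ hY (n + 1)] (Y n) :=
      ((measurable_pi_apply (Fin.last n)).comp measurable_snd).comp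
        (measurable_history hZ₀ hY (n + 1))
    have hg : Measurable fun p : H × H => p.1 + γ n • unitDir p.2 p.1 :=
      measurable_fst.add ((measurable_unitDir.comp measurable_swap).const_smul (γ n))
    rw [funext (hstep n)]
    exact hg.comp (Measurable.prodMk h₁ h₂)

/-! ### Passage to the law of `X` and conclusion -/

section Law

variable {H : Type*} [NormedAddCommGroup H] [MeasurableSpace H] [BorelSpace H]
  {Ω : Type*} [MeasurableSpace Ω] {P : Measure Ω} [IsProbabilityMeasure P] {X : Ω → H}

theorem IsGeometricMedian.integral_map_nonneg {m : H} (hm : IsGeometricMedian X P m)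
    (hX : Measurable X) (h : H) : 0 ≤ ∫ x, (‖x - h‖ - ‖x - m‖) ∂(P.map X) := by
  have : IsProbabilityMeasure (P.map X) := Measure.isProbabilityMeasure_map hX.aemeasurable
  have e : ∀ a : H, medianObjective X P a = ∫ x, (‖x - a‖ - ‖x - 0‖) ∂(P.map X) := fun a => by
    rw [integral_map hX.aemeasurable (by fun_prop)]
    simp [medianObjective]
  have h1 := hm h
  rw [e, e] at h1
  have h2 := integral_sub (integrable_norm_sub_sub_norm_sub (P.map X) h 0)
    (integrable_norm_sub_sub_norm_sub (P.map X) m 0)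
  simp only [sub_sub_sub_cancel_right] at h2
  rw [h2]
  linarith

/-- If `h'` is orthogonal to almost every `x - m`, then `⟨X, h'⟩` is almost surely the constant `⟨m,
h'⟩` and has zero variance. -/
theorem NotConcentratedOnLine.exists_notMem_aeOrthogonal {H : Type*} [NormedAddCommGroup H]
    [InnerProductSpace ℝ H] [MeasurableSpace H] {X : Ω → H} (hA : NotConcentratedOnLine X P)
    (hX : Measurable X) (m h : H) :
    ∃ h' : H, inner ℝ h h' = 0 ∧ h' ∉ aeOrthogonal (P.map X) m := by
  obtain ⟨h', h0, hv⟩ := hA h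
  refine ⟨h', h0, fun hmem => hv.ne' ?_⟩
  have h1 := ae_of_ae_map hX.aemeasurable ((mem_aeOrthogonal (P.map X) m).1 hmem)
  have h2 : (fun ω => inner ℝ (X ω) h') =ᵐ[P] fun _ => inner ℝ m h' := by
    filter_upwards [h1] with ω hω
    rw [real_inner_comm, inner_sub_left] at hω
    linarith
  rw [evariance_congr h2, evariance_eq_zero_iff aemeasurable_const]
  simp

end Law

theorem isLittleO_of_eventually_sq_lt_rpow {u : ℕ → ℝ} (hu : ∀ n, 0 ≤ u n) {b β : ℝ} (hβ : β < b)
    (h : ∀ᶠ n : ℕ in atTop, u n ^ 2 < (n : ℝ) ^ (-b)) :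
    u =o[atTop] fun n : ℕ => 1 / (n : ℝ) ^ (β / 2) := by
  have h1 : u =O[atTop] fun n : ℕ => (n : ℝ) ^ (-(b / 2)) := by
    refine IsBigO.of_bound 1 ?_
    filter_upwards [h] with n hn
    have hn0 : (0 : ℝ) ≤ (n : ℝ) ^ (-(b / 2)) := by positivity
    rw [one_mul, Real.norm_of_nonneg (hu n), Real.norm_of_nonneg hn0]
    refine le_of_sq_le_sq ?_ hn0
    rw [← Real.rpow_natCast ((n : ℝ) ^ (-(b / 2))), ← Real.rpow_mul (Nat.cast_nonneg n)]
    refine hn.le.trans_eq ?_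
    congr 1; push_cast; ring
  refine h1.trans_isLittleO ?_
  refine (isLittleO_iff_tendsto' ?_).2 ?_
  · filter_upwards [eventually_gt_atTop 0] with n hn h0
    have : (0 : ℝ) < 1 / (n : ℝ) ^ (β / 2) := by positivity
    exact absurd h0 this.ne'
  · have h2 : Tendsto (fun n : ℕ => (n : ℝ) ^ (-((b - β) / 2))) atTop (𝓝 0) :=
      (tendsto_rpow_neg_atTop (by linarith)).comp tendsto_natCast_atTop_atTop
    refine h2.congr' ?_
    filter_upwards [eventually_gt_atTop 0] with n hn
    have hn' : (0 : ℝ) < n := by exact_mod_cast hn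
    rw [div_div_eq_mul_div, div_one, ← Real.rpow_add hn']
    congr 1; ring

theorem theorem5p1
    {H : Type*} [NormedAddCommGroup H] [InnerProductSpace ℝ H] [CompleteSpace H]
    [TopologicalSpace.SeparableSpace H] [MeasurableSpace H] [BorelSpace H]
    -- the random variable `X`, its two assumptions and its geometric median
    {Ω' : Type*} [MeasurableSpace Ω'] (P : Measure Ω') [IsProbabilityMeasure P]
    (X : Ω' → H) (hX : Measurable X)
    (hA1 : NotConcentratedOnLine X P) (hA2 : NotConcentratedAroundPoints X P)
    (m : H) (hm : IsGeometricMedian X P m)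
    -- the sample `Xs 1, Xs 2, …`: independent copies of `X` (`Xs 0` plays no role)
    {Ω : Type*} [MeasurableSpace Ω] (μ : Measure Ω) [IsProbabilityMeasure μ]
    (Xs : ℕ → Ω → H) (hXs : ∀ n, 1 ≤ n → Measurable (Xs n))
    (hindep : iIndepFun (fun n : ℕ => Xs (n + 1)) μ)
    (hident : ∀ n, 1 ≤ n → IdentDistrib (Xs n) X μ P)
    -- the step sequence is `n ↦ c * n ^ (-α)`
    (c α : ℝ) (hc : 0 < c) (hα : α ∈ Set.Ioo (1 / 2 : ℝ) 1)
    -- the algorithm `Z 1, Z 2, …` (`Z 0` plays no role); `Z 1` is bounded and independent of the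
    -- sequence `Xs 2, Xs 3, …` (deterministic, or a function of `Xs 1`, for example)
    (Z : ℕ → Ω → H) (hZ1 : Measurable (Z 1))
    (hZ1_bdd : ∃ M : ℝ, ∀ᵐ ω ∂μ, ‖Z 1 ω‖ ≤ M)
    (hZ1_indep : IndepFun (Z 1) (fun ω (n : ℕ) => Xs (n + 2) ω) μ)
    (hZ : ∀ n : ℕ, 1 ≤ n → ∀ ω, Z (n + 1) ω = Z n ω +
      (c * (n : ℝ) ^ (-α)) • (‖Xs (n + 1) ω - Z n ω‖⁻¹ • (Xs (n + 1) ω - Z n ω))) :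
    ∀ β : ℝ, β < α →
      ∀ᵐ ω ∂μ, (fun n : ℕ => ‖Z n ω - m‖) =o[atTop] (fun n : ℕ => 1 / (n : ℝ) ^ (β / 2)) := by
  intro β hβ
  have : SecondCountableTopology H := UniformSpace.secondCountable_of_separable H
  have hY : ∀ n, Measurable (Xs (n + 2)) := fun n => hXs _ (by omega)
  -- Time is shifted by one: `Z 1` becomes the initial value and `Xs 2` the first observation used.
  have hrec : IsMedianRecursion μ (P.map X) (historyFiltration (Y := fun n => Xs (n + 2)) hZ1 hY)
      (fun n => c * ((n : ℝ) + 1) ^ (-α)) (fun n => Xs (n + 2)) (fun n => Z (n + 1)) := by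
    have hstep : ∀ n ω, Z (n + 1 + 1) ω = Z (n + 1) ω +
        (c * ((n : ℝ) + 1) ^ (-α)) • unitDir (Xs (n + 2) ω) (Z (n + 1) ω) := fun n ω => by
      rw [hZ (n + 1) (by omega) ω]
      push_cast
      rfl
    exact
      { adapted := measurable_historyFiltration_of_step (Z := fun n => Z (n + 1)) hZ1 hY hstep
        measurable_obs := hY
        indep := indep_historyFiltration hZ1 hY
          (hindep.precomp (g := Nat.succ) Nat.succ_injective) hZ1_indep
        map_eq := fun n => (hident _ (by omega)).map_eq
        step := hstep
        step_nonneg := fun n => by positivity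
        bdd_init := hZ1_bdd }
  have hrate := hrec.ae_eventually_norm_sub_sq_lt_rpow hc hα m
    (hA1.exists_notMem_aeOrthogonal hX m) (hm.integral_map_nonneg hX)
    -- An exponent strictly between `β` and `α`, so that the eventual bound improves to a little-o
    -- at `β`.
    (show (β + α) / 2 < α by linarith)
  filter_upwards [hrate] with ω hω
  refine isLittleO_of_eventually_sq_lt_rpow (fun n => norm_nonneg _)
    (show β < (β + α) / 2 by linarith) ?_
  rw [← map_add_atTop_eq_nat 1, eventually_map]
  simpa using hω
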